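/- Let $\phi\in[0,2\pi)$ and $U=H\,\mathrm{diag}(1,e^{i\phi})\,H^\dagger$, where $H=\frac{1}{\sqrt2}\begin{pmatrix}1&1\\1&-1\end{pmatrix}$ is the Hadamard matrix. For a $2\times2$ unitary matrix $V$ with columns $|v_0\rangle,|v_1\rangle$, let $\mathcal P_V$ be the von Neumann measurement in the basis of these columns, regarded as the channel $\mathcal P_V(\rho)=\sum_{i=0}^{1}\langle v_i|\rho|v_i\rangle\,|i\rangle\langle i|$; thus $\mathcal P_{\mathbb 1}$ is the computational-basis measurement. For a natural number $k$, a state $\rho$ on $\mathbb C^2\otimes\mathbb C^k$ (a positive semidefinite matrix of trace one) and a two-outcome POVM $\{M_0,M_1\}$ on $\mathbb C^2\otimes\mathbb C^k$ ($M_0,M_1\ge 0$, $M_0+M_1=\mathbb 1$), the probability of correctly discriminating $\mathcal P_U$ and $\mathcal P_{\mathbb 1}$, given with equal prior probabilities, is $$p(\rho,M)=\tfrac12\,\mathrm{tr}\big(M_0\,(\mathcal P_U\otimes\mathrm{id})(\rho)\big)+\tfrac12\,\mathrm{tr}\big(M_1\,(\mathcal P_{\mathbb 1}\otimes\mathrm{id})(\rho)\big).$$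 Then the optimal probability of correct discrimination, i.e. the maximum of $p(\rho,M)$ over all $k$, $\rho$ and $\{M_0,M_1\}$, exists and equals $$p_{\mathrm{succ}}(\mathcal P_U,\mathcal P_{\mathbb 1})=\frac12+\frac{|1-e^{i\phi}|}{4}.$$ The same number is the maximum of $p(\rho,M)$ over the two-qubit schemes in which $k=2$, $\rho=|\psi\rangle\langle\psi|$ with $|\psi\rangle$ a unit vector, and, after the outcome $i\in\{0,1\}$ on the first qubit, the second qubit is measured by a von Neumann measurement $\mathcal P_{V_i}$ with $V_i$ unitary, whose outcome $j=0$ means the guess $\mathcal P_U$ and $j=1$ the guess $\mathcal P_{\mathbb 1}$; that is, $M_j=\sum_{i=0}^{1}|i\rangle\langle i|\otimes V_i|j\rangle\langle j|V_i^\dagger$. -/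

import Mathlib

open scoped Kronecker ComplexOrder

noncomputable section

namespace QuantumDiscrimination

/-- The Hadamard matrix of dimension two. -/
def hadamard : Matrix (Fin 2) (Fin 2) ℂ :=
  ((Real.sqrt 2 : ℝ) : ℂ)⁻¹ • !![1, 1; 1, -1]

/-- The matrix `H diag(1, exp(iφ)) H†` of the parametrized Fourier family. -/
def fourierMatrix (φ : ℝ) : Matrix (Fin 2) (Fin 2) ℂ :=
  hadamard * Matrix.diagonal ![1, Complex.exp (φ * Complex.I)] * hadamard.conjTranspose

/-- The von Neumann measurement described by a unitary matrix `U` with columns `u_i`, as the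
measure-and-prepare channel `ρ ↦ ∑ i, ⟨u_i| ρ |u_i⟩ |i⟩⟨i|`. -/
def vonNeumann {d : Type*} [Fintype d] [DecidableEq d] (U : Matrix d d ℂ) :
    Matrix d d ℂ →ₗ[ℂ] Matrix d d ℂ where
  toFun ρ := ∑ i, Matrix.single i i (star (U.col i) ⬝ᵥ (ρ.mulVec (U.col i)))
  map_add' ρ σ := by
    simp [Matrix.add_mulVec, dotProduct_add, Matrix.single_add, Finset.sum_add_distrib]
  map_smul' c ρ := by
    simp [Matrix.smul_mulVec, dotProduct_smul, Finset.smul_sum, Matrix.smul_single]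

/-- The map `Φ ⊗ id`, with `Φ` acting on the first tensor factor and the identity on an
ancilla with basis `k`: `Φ` is applied to each of the blocks of `X` indexed by `k × k`. -/
def tensorId {d k : Type*} (Φ : Matrix d d ℂ →ₗ[ℂ] Matrix d d ℂ) :
    Matrix (d × k) (d × k) ℂ →ₗ[ℂ] Matrix (d × k) (d × k) ℂ where
  toFun X := Matrix.of fun a b => Φ (Matrix.of fun i j => X (i, a.2) (j, b.2)) a.1 b.1
  map_add' X Y := by
    ext a b
    exact congrFun (congrFun (Φ.map_add (Matrix.of fun i j => X (i, a.2) (j, b.2))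
      (Matrix.of fun i j => Y (i, a.2) (j, b.2))) a.1) b.1
  map_smul' c X := by
    ext a b
    exact congrFun (congrFun (Φ.map_smul c (Matrix.of fun i j => X (i, a.2) (j, b.2))) a.1) b.1

theorem tensorId_kronecker {d k : Type*} (Φ : Matrix d d ℂ →ₗ[ℂ] Matrix d d ℂ)
    (A : Matrix d d ℂ) (B : Matrix k k ℂ) : tensorId Φ (A ⊗ₖ B) = Φ A ⊗ₖ B := by
  ext a b
  have h : (Matrix.of fun i j => (A ⊗ₖ B) (i, a.2) (j, b.2)) = B a.2 b.2 • A := by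
    ext i j
    simp [Matrix.kroneckerMap_apply, mul_comm]
  change Φ (Matrix.of fun i j => (A ⊗ₖ B) (i, a.2) (j, b.2)) a.1 b.1 = _
  rw [h, Φ.map_smul]
  simp [Matrix.kroneckerMap_apply, mul_comm]

/-- Quantum states: positive semidefinite matrices of trace one. -/
def IsState {n : Type*} [Fintype n] (ρ : Matrix n n ℂ) : Prop :=
  ρ.PosSemidef ∧ ρ.trace = 1

/-- A POVM with outcomes in `ι`: positive semidefinite effects that sum to the identity. -/
def IsPOVM {ι n : Type*} [Fintype ι] [Fintype n] [DecidableEq n] (M : ι → Matrix n n ℂ) : Prop :=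
  (∀ j, (M j).PosSemidef) ∧ ∑ j, M j = 1

/-- The probability of a correct guess when one of the channels `Φ`, `Ψ`, each chosen with
probability `1 / 2`, is applied to the first part of the state `ρ`, the result is measured with
the effects `M 0`, `M 1`, and one guesses `Φ` on outcome `0` and `Ψ` on outcome `1`. -/
def successProb {d k : Type*} [Fintype d] [Fintype k]
    (Φ Ψ : Matrix d d ℂ →ₗ[ℂ] Matrix d d ℂ) (ρ : Matrix (d × k) (d × k) ℂ)
    (M : Fin 2 → Matrix (d × k) (d × k) ℂ) : ℝ :=
  1 / 2 * (M 0 * tensorId Φ ρ).trace.re + 1 / 2 * (M 1 * tensorId Ψ ρ).trace.re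

/-- The success probabilities of all single-shot strategies for discriminating `Φ` and `Ψ`:
an ancilla of arbitrary finite dimension, an arbitrary joint input state and an arbitrary
two-outcome POVM on the output. -/
def successProbs {d : Type*} [Fintype d] [DecidableEq d]
    (Φ Ψ : Matrix d d ℂ →ₗ[ℂ] Matrix d d ℂ) : Set ℝ :=
  {p | ∃ (k : ℕ) (ρ : Matrix (d × Fin k) (d × Fin k) ℂ)
      (M : Fin 2 → Matrix (d × Fin k) (d × Fin k) ℂ),
      IsState ρ ∧ IsPOVM M ∧ p = successProb Φ Ψ ρ M}

/-- The effect, for the final label `j`, of reading the label `i` of the first system and then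
measuring the second one in the basis of the columns of `V i`. -/
def conditionalEffect (V : Fin 2 → Matrix (Fin 2) (Fin 2) ℂ) (j : Fin 2) :
    Matrix (Fin 2 × Fin 2) (Fin 2 × Fin 2) ℂ :=
  ∑ i, Matrix.single i i 1 ⊗ₖ Matrix.vecMulVec ((V i).col j) (star ((V i).col j))

/-- The success probabilities of the two-qubit strategies: a pure joint input state `ψ`, and,
given the outcome `i` of the unknown measurement of the first qubit, the von Neumann measurement
described by the unitary `V i` of the second qubit, whose outcome `j` decides the guess. -/
def twoQubitSuccessProbs (Φ Ψ : Matrix (Fin 2) (Fin 2) ℂ →ₗ[ℂ] Matrix (Fin 2) (Fin 2) ℂ) :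
    Set ℝ :=
  {p | ∃ (ψ : Fin 2 × Fin 2 → ℂ) (V : Fin 2 → Matrix (Fin 2) (Fin 2) ℂ),
      star ψ ⬝ᵥ ψ = 1 ∧ (∀ i, V i ∈ Matrix.unitaryGroup (Fin 2) ℂ) ∧
      p = successProb Φ Ψ (Matrix.vecMulVec ψ (star ψ)) (conditionalEffect V)}

end QuantumDiscrimination

end

namespace QuantumDiscrimination

open Matrix

/-! In the dual picture the measurements act on the effects, and only the diagonal blocks `Q i` of
`M 0` matter. Put `D = |u₀⟩⟨u₀| - |0⟩⟨0|`. Two orthonormal bases of a plane have projections with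
the same sum, so the differences for the two outcomes are `D` and `-D`. Hence the success
probability is `1/2 + 1/2 tr(ρ (D ⊗ B))` with `B = Q 0 - Q 1` (`successProb_fourierMatrix`). With `s
= sin(φ/2)`, `D² = s²` gives `-s ≤ D ≤ s`, and `-1 ≤ B ≤ 1`, so `D ⊗ B ≤ s`
(`re_trace_kronecker_le`). A top eigenvector of `D`, tensored with `|0⟩`, attains `s` once `B =
diag(1, -1)`. Finally `2s = |1 - exp(iφ)|`. -/

theorem trace_mul_nonneg_of_posSemidef {n : Type*} [Fintype n] [DecidableEq n]
    {A B : Matrix n n ℂ} (hA : A.PosSemidef) (hB : B.PosSemidef) : 0 ≤ (A * B).trace := by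
  open scoped MatrixOrder in
  obtain ⟨C, hC⟩ := CStarAlgebra.nonneg_iff_eq_star_mul_self.mp hA.nonneg
  rw [hC, mul_assoc, trace_mul_comm]
  exact (hB.mul_mul_conjTranspose_same C).trace_nonneg

/-! ### Von Neumann measurements in the dual picture -/

/-- The diagonal block of `M` at the label `i` of the first tensor factor. -/
def diagBlock {d k : Type*} (M : Matrix (d × k) (d × k) ℂ) (i : d) : Matrix k k ℂ :=
  M.submatrix (fun x => (i, x)) (fun x => (i, x))

theorem tensorId_vonNeumann_apply {d k : Type*} [Fintype d] [DecidableEq d]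
    (U : Matrix d d ℂ) (ρ : Matrix (d × k) (d × k) ℂ) (a b : d × k) :
    tensorId (vonNeumann U) ρ a b =
      if a.1 = b.1 then ∑ p, ∑ q, star (U p a.1) * ρ (p, a.2) (q, b.2) * U q a.1 else 0 := by
  simp only [tensorId, vonNeumann, LinearMap.coe_mk, AddHom.coe_mk, of_apply,
    Matrix.sum_apply, single_apply]
  split_ifs with h
  · rw [Finset.sum_eq_single a.1]
    · simp [h, dotProduct, mulVec, Finset.mul_sum, mul_assoc]
    · intro i _ hi
      simp [hi]
    · simp
  · refine Finset.sum_eq_zero fun i _ => if_neg ?_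
    rintro ⟨rfl, h'⟩
    exact h h'

/-- The dual picture: applying a von Neumann measurement to the state amounts to replacing the
effect by the sum of the rank-one projections tensored with the diagonal blocks of the effect. -/
theorem trace_mul_tensorId_vonNeumann {d k : Type*} [Fintype d] [DecidableEq d] [Fintype k]
    (U : Matrix d d ℂ) (ρ M : Matrix (d × k) (d × k) ℂ) :
    (M * tensorId (vonNeumann U) ρ).trace =
      (ρ * ∑ i, vecMulVec (U.col i) (star (U.col i)) ⊗ₖ diagBlock M i).trace := by
  have hl : (M * tensorId (vonNeumann U) ρ).trace =
      ∑ i, ∑ x, ∑ y, ∑ p, ∑ q, M (i, x) (i, y) * (star (U p i) * ρ (p, y) (q, x) * U q i) := by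
    simp only [trace, diag_apply, mul_apply, tensorId_vonNeumann_apply, Fintype.sum_prod_type]
    refine Finset.sum_congr rfl fun i _ => Finset.sum_congr rfl fun x _ => ?_
    rw [Finset.sum_eq_single i]
    · simp [Finset.mul_sum]
    · intro j _ hj
      simp [hj]
    · simp
  have hr : (ρ * ∑ i, vecMulVec (U.col i) (star (U.col i)) ⊗ₖ diagBlock M i).trace =
      ∑ i, ∑ p, ∑ y, ∑ q, ∑ x, ρ (p, y) (q, x) * (U q i * star (U p i) * M (i, x) (i, y)) := by
    rw [Finset.mul_sum, trace_sum]
    simp [trace, mul_apply, Fintype.sum_prod_type, vecMulVec_apply, diagBlock]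
  rw [hl, hr]
  refine Finset.sum_congr rfl fun i _ => ?_
  calc _ = ∑ y, ∑ x, ∑ p, ∑ q, M (i, x) (i, y) * (star (U p i) * ρ (p, y) (q, x) * U q i) :=
        Finset.sum_comm
    _ = ∑ y, ∑ p, ∑ x, ∑ q, M (i, x) (i, y) * (star (U p i) * ρ (p, y) (q, x) * U q i) :=
        Finset.sum_congr rfl fun y _ => Finset.sum_comm
    _ = ∑ p, ∑ y, ∑ x, ∑ q, M (i, x) (i, y) * (star (U p i) * ρ (p, y) (q, x) * U q i) :=
        Finset.sum_comm
    _ = _ := Finset.sum_congr rfl fun p _ => Finset.sum_congr rfl fun y _ => by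
        rw [Finset.sum_comm]
        exact Finset.sum_congr rfl fun q _ => Finset.sum_congr rfl fun x _ => by ring

/-! ### Half-angle form of the effects -/

/-- The difference `|u₀⟩⟨u₀| - |0⟩⟨0|` of the effects of the two measurements, in terms of the
half angle. -/
noncomputable def effectDifference (φ : ℝ) : Matrix (Fin 2) (Fin 2) ℂ :=
  !![-(Real.sin (φ / 2) : ℂ) ^ 2, Complex.I * Real.sin (φ / 2) * Real.cos (φ / 2);
    -(Complex.I * Real.sin (φ / 2) * Real.cos (φ / 2)), (Real.sin (φ / 2) : ℂ) ^ 2]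

theorem sin_sq_add_cos_sq_ofReal (x : ℝ) : (Real.sin x : ℂ) ^ 2 + (Real.cos x : ℂ) ^ 2 = 1 := by
  exact_mod_cast Real.sin_sq_add_cos_sq x

theorem exp_mul_I_eq_half_angle_sq (φ : ℝ) :
    Complex.exp (φ * Complex.I) =
      (Real.cos (φ / 2) + Real.sin (φ / 2) * Complex.I : ℂ) ^ 2 := by
  rw [Complex.ofReal_cos, Complex.ofReal_sin, ← Complex.exp_mul_I, ← Complex.exp_nat_mul]
  congr 1
  push_cast
  ring

theorem norm_one_sub_exp_mul_I {φ : ℝ} (h : 0 ≤ Real.sin (φ / 2)) :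
    ‖1 - Complex.exp (φ * Complex.I)‖ = 2 * Real.sin (φ / 2) := by
  have h1 : 1 - Complex.exp (φ * Complex.I) = (2 * Real.sin (φ / 2) : ℝ) *
      (-Complex.I * Complex.exp ((φ / 2 : ℝ) * Complex.I)) := by
    rw [exp_mul_I_eq_half_angle_sq, Complex.exp_mul_I, ← Complex.ofReal_cos, ← Complex.ofReal_sin]
    push_cast only [Complex.ofReal_mul, Complex.ofReal_ofNat]
    linear_combination (-1 : ℂ) * sin_sq_add_cos_sq_ofReal (φ / 2) +
      (Real.sin (φ / 2) : ℂ) ^ 2 * Complex.I_sq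
  rw [h1, norm_mul, norm_mul, Complex.norm_exp_ofReal_mul_I, Complex.norm_real, norm_neg,
    Complex.norm_I, Real.norm_of_nonneg (by positivity)]
  ring

/-- Isolates the global phase `exp(iφ/2)`, which drops out of the column projections. -/
theorem fourierMatrix_eq (φ : ℝ) :
    fourierMatrix φ =
      (Real.cos (φ / 2) + Real.sin (φ / 2) * Complex.I : ℂ) •
        !![(Real.cos (φ / 2) : ℂ), -Complex.I * Real.sin (φ / 2);
          -Complex.I * Real.sin (φ / 2), (Real.cos (φ / 2) : ℂ)] := by
  have hs : ((Real.sqrt 2 : ℝ) : ℂ)⁻¹ * ((Real.sqrt 2 : ℝ) : ℂ)⁻¹ = 2⁻¹ := by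
    rw [← mul_inv, ← Complex.ofReal_mul, Real.mul_self_sqrt (by norm_num)]
    norm_num
  have hU : fourierMatrix φ = (2⁻¹ : ℂ) •
      (!![1, 1; 1, -1] * !![1, 0; 0, Complex.exp (φ * Complex.I)] * !![1, 1; 1, -1]) := by
    have hd : diagonal ![1, Complex.exp (φ * Complex.I)] =
        !![1, 0; 0, Complex.exp (φ * Complex.I)] := by
      ext i j
      fin_cases i <;> fin_cases j <;> simp
    have hH : hadamardᴴ = hadamard := by
      ext i j
      fin_cases i <;> fin_cases j <;> simp [hadamard]
    rw [fourierMatrix, hH, hd, hadamard]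
    simp only [Matrix.smul_mul, Matrix.mul_smul, smul_smul, hs]
  have h1 := sin_sq_add_cos_sq_ofReal (φ / 2)
  have h2 := Complex.I_sq
  rw [hU, exp_mul_I_eq_half_angle_sq, mul_fin_two, mul_fin_two]
  generalize (Real.cos (φ / 2) : ℂ) = c at *
  generalize (Real.sin (φ / 2) : ℂ) = s at *
  ext i j
  fin_cases i <;> fin_cases j <;>
    simp <;> linear_combination (-1 / 2 : ℂ) * h1 + (s ^ 2 / 2) * h2

theorem vecMulVec_fourierMatrix_col_zero (φ : ℝ) :
    vecMulVec ((fourierMatrix φ).col 0) (star ((fourierMatrix φ).col 0)) =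
      vecMulVec ((1 : Matrix (Fin 2) (Fin 2) ℂ).col 0)
        (star ((1 : Matrix (Fin 2) (Fin 2) ℂ).col 0)) + effectDifference φ := by
  have h1 := sin_sq_add_cos_sq_ofReal (φ / 2)
  have h2 := Complex.I_sq
  ext i j
  fin_cases i <;> fin_cases j <;>
    simp [vecMulVec_apply, fourierMatrix_eq, effectDifference, -Complex.ofReal_sin,
      -Complex.ofReal_cos]
  all_goals
    generalize (Real.cos (φ / 2) : ℂ) = c at *
    generalize (Real.sin (φ / 2) : ℂ) = s at *
    -- The global phase `c + s * I` has modulus one.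
    have hz : c ^ 2 - Complex.I ^ 2 * s ^ 2 = 1 := by linear_combination h1 - s ^ 2 * h2
  · linear_combination c ^ 2 * hz + h1
  · linear_combination (c * s * Complex.I) * hz
  · linear_combination (c * s * Complex.I) * hz
  · linear_combination (-Complex.I ^ 2 * s ^ 2) * hz - s ^ 2 * h2

theorem vecMulVec_fourierMatrix_col_one (φ : ℝ) :
    vecMulVec ((fourierMatrix φ).col 1) (star ((fourierMatrix φ).col 1)) =
      vecMulVec ((1 : Matrix (Fin 2) (Fin 2) ℂ).col 1)
        (star ((1 : Matrix (Fin 2) (Fin 2) ℂ).col 1)) - effectDifference φ := by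
  have h1 := sin_sq_add_cos_sq_ofReal (φ / 2)
  have h2 := Complex.I_sq
  ext i j
  fin_cases i <;> fin_cases j <;>
    simp [vecMulVec_apply, fourierMatrix_eq, effectDifference, -Complex.ofReal_sin,
      -Complex.ofReal_cos]
  all_goals
    generalize (Real.cos (φ / 2) : ℂ) = c at *
    generalize (Real.sin (φ / 2) : ℂ) = s at *
    have hz : c ^ 2 - Complex.I ^ 2 * s ^ 2 = 1 := by linear_combination h1 - s ^ 2 * h2
  · linear_combination (-Complex.I ^ 2 * s ^ 2) * hz - s ^ 2 * h2
  · linear_combination (c * s * Complex.I) * hz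
  · linear_combination (c * s * Complex.I) * hz
  · linear_combination c ^ 2 * hz + h1

theorem successProb_fourierMatrix {k : Type*} [Fintype k] [DecidableEq k] (φ : ℝ)
    {ρ : Matrix (Fin 2 × k) (Fin 2 × k) ℂ} (hρ : IsState ρ)
    {M : Fin 2 → Matrix (Fin 2 × k) (Fin 2 × k) ℂ} (hM : IsPOVM M) :
    successProb (vonNeumann (fourierMatrix φ)) (vonNeumann 1) ρ M =
      1 / 2 + 1 / 2 *
        (ρ * (effectDifference φ ⊗ₖ (diagBlock (M 0) 0 - diagBlock (M 0) 1))).trace.re := by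
  have hM1 : M 1 = 1 - M 0 := by
    have := hM.2
    rw [Fin.sum_univ_two] at this
    exact eq_sub_of_add_eq' this
  have hblock (i : Fin 2) : diagBlock (M 1) i = 1 - diagBlock (M 0) i := by
    ext x y
    simp [hM1, diagBlock, Matrix.one_apply]
  have hone : (∑ i : Fin 2, vecMulVec ((1 : Matrix (Fin 2) (Fin 2) ℂ).col i)
      (star ((1 : Matrix (Fin 2) (Fin 2) ℂ).col i))) = 1 := by
    ext i j
    fin_cases i <;> fin_cases j <;> simp [vecMulVec_apply, Fin.sum_univ_two]
  have hsum : (∑ i, vecMulVec ((fourierMatrix φ).col i) (star ((fourierMatrix φ).col i)) ⊗ₖ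
        diagBlock (M 0) i) +
      (∑ i, vecMulVec ((1 : Matrix (Fin 2) (Fin 2) ℂ).col i)
        (star ((1 : Matrix (Fin 2) (Fin 2) ℂ).col i)) ⊗ₖ diagBlock (M 1) i) =
      1 + effectDifference φ ⊗ₖ (diagBlock (M 0) 0 - diagBlock (M 0) 1) := by
    rw [Fin.sum_univ_two] at hone
    rw [← one_kronecker_one]
    simp only [Fin.sum_univ_two, hblock, vecMulVec_fourierMatrix_col_zero,
      vecMulVec_fourierMatrix_col_one]
    ext ⟨a, x⟩ ⟨b, y⟩
    have h := congrFun (congrFun hone a) b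
    simp only [Matrix.add_apply, Matrix.sub_apply, kroneckerMap_apply] at h ⊢
    linear_combination (1 : Matrix k k ℂ) x y * h
  rw [successProb, trace_mul_tensorId_vonNeumann, trace_mul_tensorId_vonNeumann, ← mul_add,
    ← Complex.add_re, ← trace_add, ← Matrix.mul_add, hsum, Matrix.mul_add, trace_add, mul_one, hρ.2,
    Complex.add_re, Complex.one_re]
  ring

/-! ### The upper bound -/

theorem isHermitian_effectDifference (φ : ℝ) : (effectDifference φ).IsHermitian := by
  ext i j
  fin_cases i <;> fin_cases j <;> simp [effectDifference, -Complex.ofReal_sin,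
    -Complex.ofReal_cos]

/-- Cayley–Hamilton: the matrix has trace zero and determinant `-sin²(φ/2)`. -/
theorem effectDifference_mul_self (φ : ℝ) :
    effectDifference φ * effectDifference φ = ((Real.sin (φ / 2) : ℂ) ^ 2) • 1 := by
  have h1 := sin_sq_add_cos_sq_ofReal (φ / 2)
  have h2 := Complex.I_sq
  rw [effectDifference]
  generalize (Real.cos (φ / 2) : ℂ) = c at *
  generalize (Real.sin (φ / 2) : ℂ) = s at *
  ext i j
  fin_cases i <;> fin_cases j <;> simp [Matrix.mul_apply, Fin.sum_univ_two]
  · linear_combination s ^ 2 * h1 - s ^ 2 * c ^ 2 * h2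
  · ring
  · ring
  · linear_combination s ^ 2 * h1 - s ^ 2 * c ^ 2 * h2

/-- A Hermitian matrix whose square is `s ^ 2` has spectrum bounded below by `-s`. -/
theorem posSemidef_smul_one_add_of_mul_self {n : Type*} [Fintype n] [DecidableEq n]
    {D : Matrix n n ℂ} (hD : D.IsHermitian) {s : ℝ} (hs : 0 ≤ s)
    (h : D * D = ((s : ℂ) ^ 2) • 1) : ((s : ℂ) • 1 + D).PosSemidef := by
  rcases hs.eq_or_lt with rfl | hs
  · have : D = 0 := by
      rw [← Matrix.conjTranspose_mul_self_eq_zero, hD.eq, h]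
      simp
    simpa [this] using Matrix.PosSemidef.zero
  · have hH : ((s : ℂ) • 1 + D)ᴴ = (s : ℂ) • 1 + D := by
      simp [hD.eq, conjTranspose_smul]
    -- `(s + D)² = 2s (s + D)`, so for `s > 0` the matrix `s + D` is a positive multiple of a Gram
    -- matrix.
    have hsq : ((s : ℂ) • 1 + D)ᴴ * ((s : ℂ) • 1 + D) = (2 * s : ℂ) • ((s : ℂ) • 1 + D) := by
      rw [hH, add_mul, mul_add, mul_add, h]
      simp only [smul_mul_assoc, mul_smul_comm, one_mul, mul_one]
      module
    have hp := posSemidef_conjTranspose_mul_self ((s : ℂ) • 1 + D)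
    rw [hsq] at hp
    have h2 : (0 : ℂ) ≤ ((2 * s)⁻¹ : ℝ) := by
      exact_mod_cast (by positivity : (0 : ℝ) ≤ (2 * s)⁻¹)
    have := hp.smul h2
    rwa [smul_smul, Complex.ofReal_inv, Complex.ofReal_mul, Complex.ofReal_ofNat,
      inv_mul_cancel₀ (by norm_cast; positivity), one_smul] at this

/-- `2s - 2 D ⊗ B = (s + D) ⊗ (1 - B) + (s - D) ⊗ (1 + B)` is a sum of tensor products of positive
matrices. -/
theorem re_trace_kronecker_le {d k : Type*} [Fintype d] [DecidableEq d] [Fintype k] [DecidableEq k]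
    {ρ : Matrix (d × k) (d × k) ℂ} (hρ : IsState ρ) {D : Matrix d d ℂ} (hD : D.IsHermitian)
    {s : ℝ} (hs : 0 ≤ s) (h : D * D = ((s : ℂ) ^ 2) • 1) {B : Matrix k k ℂ}
    (hB : (1 + B).PosSemidef) (hB' : (1 - B).PosSemidef) : (ρ * (D ⊗ₖ B)).trace.re ≤ s := by
  have h1 := (posSemidef_smul_one_add_of_mul_self hD hs h).kronecker hB'
  have h2 := (posSemidef_smul_one_add_of_mul_self hD.neg hs (by simpa using h)).kronecker hB
  have h3 := trace_mul_nonneg_of_posSemidef hρ.1 (h1.add h2)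
  have h4 : (((s : ℂ) • 1 + D) ⊗ₖ (1 - B) + ((s : ℂ) • 1 + -D) ⊗ₖ (1 + B)) =
      (2 * s : ℂ) • (1 : Matrix (d × k) (d × k) ℂ) - (2 : ℂ) • D ⊗ₖ B := by
    rw [← one_kronecker_one]
    ext ⟨a, x⟩ ⟨b, y⟩
    simp only [Matrix.add_apply, Matrix.sub_apply, Matrix.neg_apply, Matrix.smul_apply,
      kroneckerMap_apply, smul_eq_mul]
    ring
  rw [h4, mul_sub, trace_sub, mul_smul_comm, mul_smul_comm, trace_smul, trace_smul, mul_one,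
    hρ.2] at h3
  have h5 := (Complex.le_def.mp h3).1
  simp at h5
  linarith

theorem IsPOVM.posSemidef_one_sub {n : Type*} [Fintype n] [DecidableEq n]
    {M : Fin 2 → Matrix n n ℂ} (hM : IsPOVM M) : (1 - M 0).PosSemidef := by
  rw [← hM.2, Fin.sum_univ_two, add_sub_cancel_left]
  exact hM.1 1

theorem successProb_fourierMatrix_le {k : Type*} [Fintype k] [DecidableEq k] {φ : ℝ}
    (hφ : 0 ≤ Real.sin (φ / 2))
    {ρ : Matrix (Fin 2 × k) (Fin 2 × k) ℂ} (hρ : IsState ρ)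
    {M : Fin 2 → Matrix (Fin 2 × k) (Fin 2 × k) ℂ} (hM : IsPOVM M) :
    successProb (vonNeumann (fourierMatrix φ)) (vonNeumann 1) ρ M ≤
      1 / 2 + Real.sin (φ / 2) / 2 := by
  have hp (i : Fin 2) : (diagBlock (M 0) i).PosSemidef := (hM.1 0).submatrix _
  have hq (i : Fin 2) : (1 - diagBlock (M 0) i).PosSemidef := by
    convert hM.posSemidef_one_sub.submatrix (fun x => (i, x)) using 1
    ext x y
    simp [diagBlock, Matrix.one_apply]
  have := re_trace_kronecker_le hρ (isHermitian_effectDifference φ) hφ (effectDifference_mul_self φ)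
    (B := diagBlock (M 0) 0 - diagBlock (M 0) 1)
    -- `1 + B = Q 0 + (1 - Q 1)` and `1 - B = Q 1 + (1 - Q 0)`.
    (by convert (hp 0).add (hq 1) using 1; abel) (by convert (hp 1).add (hq 0) using 1; abel)
  rw [successProb_fourierMatrix φ hρ hM]
  linarith

/-! ### Attaining the bound with two qubits -/

theorem isState_vecMulVec {n : Type*} [Fintype n] {ψ : n → ℂ} (hψ : star ψ ⬝ᵥ ψ = 1) :
    IsState (vecMulVec ψ (star ψ)) :=
  ⟨posSemidef_vecMulVec_self_star ψ, by rw [trace_vecMulVec, dotProduct_comm, hψ]⟩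

theorem isPOVM_conditionalEffect {V : Fin 2 → Matrix (Fin 2) (Fin 2) ℂ}
    (hV : ∀ i, V i ∈ unitaryGroup (Fin 2) ℂ) : IsPOVM (conditionalEffect V) := by
  refine ⟨fun j => posSemidef_sum _ fun i _ => ?_, ?_⟩
  · refine PosSemidef.kronecker ?_ (posSemidef_vecMulVec_self_star _)
    rw [← diagonal_single]
    exact PosSemidef.diagonal (Pi.single_nonneg.mpr zero_le_one)
  · have hcol (i : Fin 2) : ∑ j, vecMulVec ((V i).col j) (star ((V i).col j)) = 1 := by
      rw [← mem_unitaryGroup_iff.mp (hV i)]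
      ext a b
      simp [vecMulVec_apply, Matrix.mul_apply, Matrix.sum_apply]
    have h1 (i : Fin 2) : ∑ j, (Matrix.single i i (1 : ℂ)) ⊗ₖ
        vecMulVec ((V i).col j) (star ((V i).col j)) = Matrix.single i i 1 ⊗ₖ 1 := by
      rw [← hcol i]
      ext ⟨a, x⟩ ⟨b, y⟩
      simp [Matrix.sum_apply, mul_add]
    simp only [conditionalEffect]
    rw [Finset.sum_comm]
    simp only [h1]
    ext ⟨a, x⟩ ⟨b, y⟩
    fin_cases a <;> fin_cases b <;> simp [Matrix.one_apply, Fin.sum_univ_two]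

theorem twoQubitSuccessProbs_subset_successProbs
    (Φ Ψ : Matrix (Fin 2) (Fin 2) ℂ →ₗ[ℂ] Matrix (Fin 2) (Fin 2) ℂ) :
    twoQubitSuccessProbs Φ Ψ ⊆ successProbs Φ Ψ := by
  rintro _ ⟨ψ, V, hψ, hV, rfl⟩
  exact ⟨2, _, _, isState_vecMulVec hψ, isPOVM_conditionalEffect hV, rfl⟩

/-- The optimal input: the top eigenvector of `effectDifference φ`, next to a fixed ancilla. -/
noncomputable def optimalInput (φ : ℝ) (p : Fin 2 × Fin 2) : ℂ :=
  ((Real.sqrt (2 * (1 + Real.sin (φ / 2))) : ℝ) : ℂ)⁻¹ *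
    (![Complex.I * Real.cos (φ / 2), 1 + Real.sin (φ / 2)] p.1 * ![1, 0] p.2)

/-- The optimal final measurements: the outcome of the second one is relabelled. -/
def optimalMeasurement : Fin 2 → Matrix (Fin 2) (Fin 2) ℂ :=
  ![1, !![0, 1; 1, 0]]

theorem optimalMeasurement_mem_unitaryGroup (i : Fin 2) :
    optimalMeasurement i ∈ unitaryGroup (Fin 2) ℂ := by
  rw [mem_unitaryGroup_iff]
  ext a b
  fin_cases i <;> fin_cases a <;> fin_cases b <;>
    simp [optimalMeasurement, Matrix.mul_apply, Fin.sum_univ_two, Matrix.one_apply]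

/-- `2(1 + s)` is the squared norm `c² + (1 + s)²` of the unnormalised input, positive even at `s =
0`. -/
theorem sqrt_inv_mul_self {φ : ℝ} (hφ : 0 ≤ Real.sin (φ / 2)) :
    ((Real.sqrt (2 * (1 + Real.sin (φ / 2))) : ℝ) : ℂ)⁻¹ *
      ((Real.sqrt (2 * (1 + Real.sin (φ / 2))) : ℝ) : ℂ)⁻¹ * (2 * (1 + Real.sin (φ / 2))) = 1 := by
  have h : (0 : ℝ) < 2 * (1 + Real.sin (φ / 2)) := by positivity
  rw [← mul_inv, ← Complex.ofReal_mul, Real.mul_self_sqrt h.le]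
  have h' : ((2 * (1 + Real.sin (φ / 2)) : ℝ) : ℂ) ≠ 0 := by exact_mod_cast h.ne'
  rw [show (2 * (1 + Real.sin (φ / 2)) : ℂ) =
    ((2 * (1 + Real.sin (φ / 2)) : ℝ) : ℂ) by push_cast; rfl]
  exact inv_mul_cancel₀ h'

theorem optimalInput_unit {φ : ℝ} (hφ : 0 ≤ Real.sin (φ / 2)) :
    star (optimalInput φ) ⬝ᵥ optimalInput φ = 1 := by
  have h1 := sin_sq_add_cos_sq_ofReal (φ / 2)
  have h2 := Complex.I_sq
  have h3 := sqrt_inv_mul_self hφ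
  simp only [dotProduct, Fintype.sum_prod_type, Fin.sum_univ_two, Pi.star_apply, optimalInput,
    star_mul', star_inv₀, RCLike.star_def, Complex.conj_ofReal, Matrix.cons_val_zero,
    Matrix.cons_val_one, Complex.conj_I, map_add, map_one, map_zero, map_mul]
  generalize ((Real.sqrt (2 * (1 + Real.sin (φ / 2))) : ℝ) : ℂ)⁻¹ = r at *
  generalize (Real.cos (φ / 2) : ℂ) = c at *
  generalize (Real.sin (φ / 2) : ℂ) = s at *
  linear_combination h3 + r ^ 2 * h1 - r ^ 2 * c ^ 2 * h2

/-- The input is a product of eigenvectors: of `D` with eigenvalue `sin(φ/2)`, and of `B = diag(1,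
-1)` with eigenvalue `1`. The swap of labels on outcome `1` is what produces this `B`. -/
theorem trace_optimalInput {φ : ℝ} (hφ : 0 ≤ Real.sin (φ / 2)) :
    (vecMulVec (optimalInput φ) (star (optimalInput φ)) *
      (effectDifference φ ⊗ₖ (diagBlock (conditionalEffect optimalMeasurement 0) 0 -
        diagBlock (conditionalEffect optimalMeasurement 0) 1))).trace = Real.sin (φ / 2) := by
  have hB : diagBlock (conditionalEffect optimalMeasurement 0) 0 -
      diagBlock (conditionalEffect optimalMeasurement 0) 1 = !![1, 0; 0, -1] := by
    ext x y
    fin_cases x <;> fin_cases y <;>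
      simp [diagBlock, conditionalEffect, optimalMeasurement, Fin.sum_univ_two, vecMulVec_apply]
  have h1 := sin_sq_add_cos_sq_ofReal (φ / 2)
  have h2 := Complex.I_sq
  have h3 := sqrt_inv_mul_self hφ
  rw [hB]
  simp only [trace, diag_apply, Matrix.mul_apply, Fintype.sum_prod_type, Fin.sum_univ_two,
    Pi.star_apply, optimalInput, vecMulVec_apply, kroneckerMap_apply, effectDifference, of_apply,
    cons_val', cons_val_fin_one,
    star_mul', star_inv₀, RCLike.star_def, Complex.conj_ofReal, Matrix.cons_val_zero,
    Matrix.cons_val_one, Complex.conj_I, map_add, map_one, map_zero, map_mul]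
  generalize ((Real.sqrt (2 * (1 + Real.sin (φ / 2))) : ℝ) : ℂ)⁻¹ = r at *
  generalize (Real.cos (φ / 2) : ℂ) = c at *
  generalize (Real.sin (φ / 2) : ℂ) = s at *
  linear_combination s * h3 + r ^ 2 * (2 * s + s ^ 2) * h1 -
    r ^ 2 * (2 * c ^ 2 * s + c ^ 2 * s ^ 2) * h2

theorem mem_twoQubitSuccessProbs {φ : ℝ} (hφ : 0 ≤ Real.sin (φ / 2)) :
    1 / 2 + Real.sin (φ / 2) / 2 ∈
      twoQubitSuccessProbs (vonNeumann (fourierMatrix φ)) (vonNeumann 1) := by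
  refine ⟨optimalInput φ, optimalMeasurement, optimalInput_unit hφ,
    optimalMeasurement_mem_unitaryGroup, ?_⟩
  rw [successProb_fourierMatrix φ (isState_vecMulVec (optimalInput_unit hφ))
    (isPOVM_conditionalEffect optimalMeasurement_mem_unitaryGroup), trace_optimalInput hφ,
    Complex.ofReal_re]
  ring

end QuantumDiscrimination

theorem mainTheorem1 (φ : ℝ) (hφ : φ ∈ Set.Ico 0 (2 * Real.pi)) :
    IsGreatest
        (QuantumDiscrimination.successProbs
          (QuantumDiscrimination.vonNeumann (QuantumDiscrimination.fourierMatrix φ))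
          (QuantumDiscrimination.vonNeumann 1))
        (1 / 2 + ‖1 - Complex.exp (φ * Complex.I)‖ / 4) ∧
      IsGreatest
        (QuantumDiscrimination.twoQubitSuccessProbs
          (QuantumDiscrimination.vonNeumann (QuantumDiscrimination.fourierMatrix φ))
          (QuantumDiscrimination.vonNeumann 1))
        (1 / 2 + ‖1 - Complex.exp (φ * Complex.I)‖ / 4) := by
  -- The range of `φ` puts the half angle in `[0, π)`, so no absolute value of the sine is needed.
  have hs : 0 ≤ Real.sin (φ / 2) :=
    Real.sin_nonneg_of_nonneg_of_le_pi (by linarith [hφ.1]) (by linarith [hφ.2])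
  rw [QuantumDiscrimination.norm_one_sub_exp_mul_I hs,
    show 2 * Real.sin (φ / 2) / 4 = Real.sin (φ / 2) / 2 by ring]
  have hsub := QuantumDiscrimination.twoQubitSuccessProbs_subset_successProbs
    (QuantumDiscrimination.vonNeumann (QuantumDiscrimination.fourierMatrix φ))
    (QuantumDiscrimination.vonNeumann 1)
  have hmem := QuantumDiscrimination.mem_twoQubitSuccessProbs hs
  have hle : 1 / 2 + Real.sin (φ / 2) / 2 ∈ upperBounds (QuantumDiscrimination.successProbs
      (QuantumDiscrimination.vonNeumann (QuantumDiscrimination.fourierMatrix φ))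
      (QuantumDiscrimination.vonNeumann 1)) := by
    rintro _ ⟨k, ρ, M, hρ, hM, rfl⟩
    exact QuantumDiscrimination.successProb_fourierMatrix_le hs hρ hM
  exact ⟨⟨hsub hmem, hle⟩, hmem, fun _ hp => hle (hsub hp)⟩
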